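/- Setup. A bit $\Theta$ is uniform on $\{0,1\}$. A binary-input discrete memoryless channel (DMC) $W$ with finite output alphabet has transition probabilities $W(y|x)$, $x\in\{0,1\}$. Given binary-input DMCs $P$ and $Q$, a teacher observes, at times $i=1,\dots,n$, symbols $Y_i$ that are i.i.d. with law $P(\cdot|\Theta)$ given $\Theta$, and sends at time $i$ a bit $\hat X_i$ that is a function of $Y_1,\dots,Y_i$ only. The student receives $Z_i\sim Q(\cdot|\hat X_i)$, the channel uses of $Q$ being independent given the inputs, and after time $n$ outputs an estimate $\hat\Theta_n\in\{0,1\}$ that is a function of $Z_1,\dots,Z_n$. A protocol consists of a choice of these functions for every $n$; its learning rate is $\limsup_{n\to\infty}-\frac1n\ln\mathbb P(\hat\Theta_n\neq\Theta)$, and $\mathcal R^*(P,Q)$ denotes the supremum of the learning rates over all protocols (the optimal learning rate). For a binary-input DMC $W$ put $$\mu_W(s)=\ln\sum_y W(y|0)^{1-s}\,W(y|1)^{s}\qquad(0<s<1),$$ extended to $s\in\{0,1\}$ by continuity. Corollary. There exist binary-input DMCs $P$ and $Q$ such that the optimal learning rate is strictly smaller than the trivial data-processing bound: $$\mathcal R^*(P,Q)<-\max\Big(\min_{s\in[0,1]}\mu_P(s),\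 \min_{s\in[0,1]}\mu_Q(s)\Big).$$ Specifically, this holds when $P$ is the reverse Z-channel with parameter $0.8$ (outputs in $\{0,1\}$, $P(1|1)=1$, $P(1|0)=0.8$) and $Q$ is the binary symmetric channel with crossover probability $0.2$. -/

import Mathlib

open Filter

noncomputable section

/-- A binary-input discrete memoryless channel with finite output alphabet `Y`: `prob x y` is the
transition probability `W(y | x)`. The inputs `0` and `1` are `false` and `true`. -/
structure BinaryInputDMC (Y : Type*) [Fintype Y] where
  prob : Bool → Y → ℝ
  prob_nonneg : ∀ x y, 0 ≤ prob x y
  sum_prob : ∀ x, ∑ y, prob x y = 1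

/-- `W` is the reverse Z-channel with parameter `q`: `W(1 | 1) = 1` and `W(1 | 0) = q`. -/
def BinaryInputDMC.IsReverseZ (W : BinaryInputDMC Bool) (q : ℝ) : Prop :=
  W.prob true true = 1 ∧ W.prob false true = q

/-- `W` is the binary symmetric channel with crossover probability `q`. -/
def BinaryInputDMC.IsBSC (W : BinaryInputDMC Bool) (q : ℝ) : Prop :=
  ∀ x : Bool, W.prob x (!x) = q ∧ W.prob x x = 1 - q

/-- `ρ(a, b, s) = ∑ x, a(x)^(1-s) b(x)^s` for `0 < s < 1`, extended by continuity to `s = 0` and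
`s = 1`. Restricting the sum to the common support changes nothing for `0 < s < 1` and gives the
continuous extension at the end points (see the next two lemmas). -/
def chernoffCoeff {Y : Type*} [Fintype Y] (a b : Y → ℝ) (s : ℝ) : ℝ :=
  ∑ y, if a y = 0 ∨ b y = 0 then 0 else a y ^ (1 - s) * b y ^ s

theorem chernoffCoeff_eq_sum {Y : Type*} [Fintype Y] (a b : Y → ℝ) {s : ℝ}
    (hs : s ∈ Set.Ioo (0 : ℝ) 1) :
    chernoffCoeff a b s = ∑ y, a y ^ (1 - s) * b y ^ s := by
  refine Finset.sum_congr rfl fun y _ => ?_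
  have h1 : (1 : ℝ) - s ≠ 0 := by linarith [hs.2]
  have h2 : s ≠ 0 := hs.1.ne'
  split_ifs with h
  · rcases h with h | h
    · simp [h, Real.zero_rpow h1]
    · simp [h, Real.zero_rpow h2]
  · rfl

theorem continuous_chernoffCoeff {Y : Type*} [Fintype Y] (a b : Y → ℝ)
    (ha : ∀ y, 0 ≤ a y) (hb : ∀ y, 0 ≤ b y) : Continuous (chernoffCoeff a b) := by
  refine continuous_finsetSum _ fun y _ => ?_
  by_cases h : a y = 0 ∨ b y = 0
  · simp only [h, if_true]
    exact continuous_const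
  · simp only [h, if_false]
    push Not at h
    have h1 : 0 < a y := lt_of_le_of_ne (ha y) (Ne.symm h.1)
    have h2 : 0 < b y := lt_of_le_of_ne (hb y) (Ne.symm h.2)
    exact ((Real.continuous_const_rpow h1.ne').comp (continuous_const.sub continuous_id)).mul
      (Real.continuous_const_rpow h2.ne')

/-- `μ_W(s) = ln ρ(W(· | 0), W(· | 1), s)`, with the value `-∞` where `ρ` vanishes. -/
def BinaryInputDMC.mu {Y : Type*} [Fintype Y] (W : BinaryInputDMC Y) (s : ℝ) : EReal :=
  ENNReal.log (ENNReal.ofReal (chernoffCoeff (W.prob false) (W.prob true) s))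

/-- `min_{s ∈ [0,1]} μ_W(s)` (the infimum of a continuous function on a compact interval). -/
def BinaryInputDMC.minMu {Y : Type*} [Fintype Y] (W : BinaryInputDMC Y) : EReal :=
  ⨅ s ∈ Set.Icc (0 : ℝ) 1, W.mu s

/-- A teaching and learning protocol: for every horizon `n`, the bit `teacher n i y` that the
teacher sends at time `i` upon observing `y`, which depends only on the observations up to and
including time `i`, and the estimate `student n z` that the student forms from all `n` received
symbols `z`. -/
structure TeachingProtocol (Y Z : Type*) where
  teacher : (n : ℕ) → Fin n → (Fin n → Y) → Bool
  causal : ∀ (n : ℕ) (i : Fin n) (y y' : Fin n → Y),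
    (∀ j, j ≤ i → y j = y' j) → teacher n i y = teacher n i y'
  student : (n : ℕ) → (Fin n → Z) → Bool

variable {Y Z : Type*} [Fintype Y] [Fintype Z]

/-- The probability that `Θ = θ`, that the teacher observes `y` and that the student receives `z`
when `Θ` is uniform on `{0, 1}` and both channels are memoryless. -/
def TeachingProtocol.jointProb (π : TeachingProtocol Y Z) (P : BinaryInputDMC Y)
    (Q : BinaryInputDMC Z) (n : ℕ) (θ : Bool) (y : Fin n → Y) (z : Fin n → Z) : ℝ :=
  1 / 2 * (∏ i, P.prob θ (y i)) * ∏ i, Q.prob (π.teacher n i y) (z i)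

/-- The probability that the student's estimate after `n` transmissions differs from `Θ`. -/
def TeachingProtocol.errorProb (π : TeachingProtocol Y Z) (P : BinaryInputDMC Y)
    (Q : BinaryInputDMC Z) (n : ℕ) : ℝ :=
  ∑ θ : Bool, ∑ y : Fin n → Y, ∑ z : Fin n → Z,
    if π.student n z = θ then 0 else π.jointProb P Q n θ y z

/-- The learning rate `limsup_{n → ∞} -(1/n) ln ℙ(Θ̂ₙ ≠ Θ)`, in the extended reals (`ln 0 = -∞`). -/
def TeachingProtocol.learningRate (π : TeachingProtocol Y Z) (P : BinaryInputDMC Y)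
    (Q : BinaryInputDMC Z) : EReal :=
  limsup (fun n : ℕ => -ENNReal.log (ENNReal.ofReal (π.errorProb P Q n)) / (n : EReal)) atTop

/-- The optimal learning rate: the supremum of the learning rates of all protocols. -/
def optimalLearningRate (P : BinaryInputDMC Y) (Q : BinaryInputDMC Z) : EReal :=
  ⨆ π : TeachingProtocol Y Z, π.learningRate P Q

end

/-! If `Θ = 1` the teacher sees only `true`; if `Θ = 0` its first `t` symbols are all `true` with
probability `(4/5)^t`. By causality its first `t` bits then agree in both cases, so only the last `n
- t` channel uses can help the student, and its error is at least half the Bayes error `testMass (n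
- t) 1 ((4/5)^t)` (`testMass_le_two_mul_errorProb`). With `n = 9l`, `t = 6l`, the received words
with `2l` flips out of `3l` give an error of order at least `(4/25)^l` (`testMass_three_mul_ge`).
The rate is thus at most `ln(25/4)/9 ≈ 0.204`, whereas both channels give the trivial bound at least
`ln(5/4) ≈ 0.223`. -/

/-! ### Bayes error of a weighted binary test. -/

/-- The sum over `z ∈ {0,1}^k` of the smaller of `a` times the probability of `z` under
`k` independent bits of bias `1/5` and `b` times that under bias `4/5`. -/
noncomputable def testMass : ℕ → ℝ → ℝ → ℝ
  | 0, a, b => min a b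
  | k + 1, a, b => testMass k (4 / 5 * a) (1 / 5 * b) + testMass k (1 / 5 * a) (4 / 5 * b)

/-- An extra received symbol can only lower the Bayes error. This lets an upper bound on a Hamming
distance replace its exact value. -/
theorem testMass_succ_le (k : ℕ) (a b : ℝ) : testMass (k + 1) a b ≤ testMass k a b := by
  induction k generalizing a b with
  | zero =>
    simp only [testMass]
    refine le_min ?_ ?_
    · linarith [min_le_left (4 / 5 * a) (1 / 5 * b), min_le_left (1 / 5 * a) (4 / 5 * b)]
    · linarith [min_le_right (4 / 5 * a) (1 / 5 * b), min_le_right (1 / 5 * a) (4 / 5 * b)]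
  | succ k ih => exact add_le_add (ih _ _) (ih _ _)

theorem testMass_antitone (a b : ℝ) : Antitone fun k => testMass k a b :=
  antitone_nat_of_succ_le fun k => testMass_succ_le k a b

theorem testMass_nonneg (k : ℕ) {a b : ℝ} (ha : 0 ≤ a) (hb : 0 ≤ b) : 0 ≤ testMass k a b := by
  induction k generalizing a b with
  | zero => exact le_min ha hb
  | succ k ih =>
    rw [testMass]
    exact add_nonneg (ih (by positivity) (by positivity)) (ih (by positivity) (by positivity))

theorem testMass_mul (k : ℕ) {c : ℝ} (hc : 0 ≤ c) (a b : ℝ) :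
    testMass k (c * a) (c * b) = c * testMass k a b := by
  induction k generalizing a b with
  | zero => exact (mul_min_of_nonneg a b hc).symm
  | succ k ih =>
    simp only [testMass, mul_left_comm _ c, ih, mul_add]

/-- Keeps only the words with exactly `j` ones, which all contribute the same minimum; the induction
on the first letter is Pascal's rule. -/
theorem choose_mul_min_le_testMass (i j : ℕ) {a b : ℝ} (ha : 0 ≤ a) (hb : 0 ≤ b) :
    ((i + j).choose j : ℝ) *
      min (a * ((4 / 5) ^ i * (1 / 5) ^ j)) (b * ((1 / 5) ^ i * (4 / 5) ^ j)) ≤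
        testMass (i + j) a b := by
  induction h : i + j generalizing i j a b with
  | zero =>
    obtain ⟨rfl, rfl⟩ : i = 0 ∧ j = 0 := by omega
    simp [testMass]
  | succ k ih =>
    have ha1 : (0 : ℝ) ≤ 4 / 5 * a := by positivity
    have ha2 : (0 : ℝ) ≤ 1 / 5 * a := by positivity
    have hb1 : (0 : ℝ) ≤ 1 / 5 * b := by positivity
    have hb2 : (0 : ℝ) ≤ 4 / 5 * b := by positivity
    simp only [testMass]
    rcases j with _ | j
    · obtain rfl : i = k + 1 := by omega
      have h1 := ih k 0 ha1 hb1 rfl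
      have h2 := testMass_nonneg k ha2 hb2
      simp only [Nat.choose_zero_right, Nat.cast_one, one_mul, pow_zero, mul_one] at h1 ⊢
      rw [show a * (4 / 5 : ℝ) ^ (k + 1) = 4 / 5 * a * (4 / 5) ^ k by ring,
        show b * (1 / 5 : ℝ) ^ (k + 1) = 1 / 5 * b * (1 / 5) ^ k by ring]
      linarith
    · have h2 := ih i j ha2 hb2 (by omega)
      rw [show 1 / 5 * a * ((4 / 5 : ℝ) ^ i * (1 / 5) ^ j)
          = a * ((4 / 5) ^ i * (1 / 5) ^ (j + 1)) by ring,
        show 4 / 5 * b * ((1 / 5 : ℝ) ^ i * (4 / 5) ^ j)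
          = b * ((1 / 5) ^ i * (4 / 5) ^ (j + 1)) by ring] at h2
      rw [Nat.choose_succ_succ, Nat.cast_add, add_mul]
      rcases i with _ | i
      · obtain rfl : k = j := by omega
        have h1 := testMass_nonneg k ha1 hb1
        rw [Nat.choose_succ_self, Nat.cast_zero, zero_mul]
        linarith
      · have h1 := ih i (j + 1) ha1 hb1 (by omega)
        rw [show 4 / 5 * a * ((4 / 5 : ℝ) ^ i * (1 / 5) ^ (j + 1))
            = a * ((4 / 5) ^ (i + 1) * (1 / 5) ^ (j + 1)) by ring,
          show 1 / 5 * b * ((1 / 5 : ℝ) ^ i * (4 / 5) ^ (j + 1))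
            = b * ((1 / 5) ^ (i + 1) * (4 / 5) ^ (j + 1)) by ring] at h1
        linarith

/-- The ratio of consecutive binomials is exactly `5` at `l = 1` and larger afterwards. At `l = 0`
it is only `3`, which the factor `2` absorbs. -/
theorem five_pow_le_two_mul_choose (l : ℕ) : 5 ^ l ≤ 2 * (l + 2 * l).choose (2 * l) := by
  have key (l : ℕ) (hl : 1 ≤ l) : 5 * (l + 2 * l).choose (2 * l) ≤
      (l + 1 + 2 * (l + 1)).choose (2 * (l + 1)) := by
    have h1 := Nat.add_choose_mul_factorial_mul_factorial l (2 * l)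
    have h2 := Nat.add_choose_mul_factorial_mul_factorial (l + 1) (2 * (l + 1))
    rw [show l + 1 + 2 * (l + 1) = l + 2 * l + 1 + 1 + 1 by ring] at h2 ⊢
    rw [show 2 * (l + 1) = 2 * l + 1 + 1 by ring] at h2 ⊢
    simp only [Nat.factorial_succ] at h2
    rw [← h1] at h2
    set C := (l + 2 * l).choose (2 * l)
    set D := (l + 2 * l + 1 + 1 + 1).choose (2 * l + 1 + 1)
    have hpos : 0 < Nat.factorial l * Nat.factorial (2 * l) := by positivity
    have h3 : D * ((l + 1) * ((2 * l + 1 + 1) * (2 * l + 1))) =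
        (l + 2 * l + 1 + 1 + 1) * ((l + 2 * l + 1 + 1) * (l + 2 * l + 1)) * C := by
      refine Nat.eq_of_mul_eq_mul_right hpos ?_
      linarith
    have h4 : 5 * ((l + 1) * ((2 * l + 1 + 1) * (2 * l + 1))) ≤
        (l + 2 * l + 1 + 1 + 1) * ((l + 2 * l + 1 + 1) * (l + 2 * l + 1)) := by
      obtain ⟨k, rfl⟩ := Nat.exists_eq_add_of_le hl
      ring_nf
      nlinarith
    have h5 : 0 < (l + 1) * ((2 * l + 1 + 1) * (2 * l + 1)) := by positivity
    refine Nat.le_of_mul_le_mul_right ?_ h5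
    rw [h3]
    nlinarith
  induction l with
  | zero => simp
  | succ l ih =>
    rcases Nat.eq_zero_or_pos l with rfl | hl
    · decide
    · have := key l hl
      rw [pow_succ]
      omega

theorem testMass_three_mul_ge (l t : ℕ) (ht : t ≤ 6 * l) :
    1 / 2 * (4 / 25 : ℝ) ^ l ≤ testMass (3 * l) 1 ((4 / 5) ^ t) := by
  have h := choose_mul_min_le_testMass l (2 * l) zero_le_one
    (show (0 : ℝ) ≤ (4 / 5) ^ t by positivity)
  rw [show l + 2 * l = 3 * l by ring] at h
  refine le_trans ?_ h
  have hc : (5 : ℝ) ^ l ≤ 2 * ((3 * l).choose (2 * l) : ℝ) := by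
    have := five_pow_le_two_mul_choose l
    rw [show l + 2 * l = 3 * l by ring] at this
    exact_mod_cast this
  have hm : (4 / 125 : ℝ) ^ l ≤ min (1 * ((4 / 5) ^ l * (1 / 5) ^ (2 * l)))
      ((4 / 5) ^ t * ((1 / 5) ^ l * (4 / 5) ^ (2 * l))) := by
    refine le_min ?_ ?_
    · rw [one_mul, pow_mul, ← mul_pow]
      norm_num
    · have hw : ((4 / 5 : ℝ) ^ 6) ^ l ≤ (4 / 5) ^ t := by
        rw [← pow_mul]
        exact pow_le_pow_of_le_one (by norm_num) (by norm_num) ht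
      -- Numerically `(4/5)^8 / 5 ≈ 0.0336 ≥ 0.032 = 4/125`: the split `6 : 3` with `2l` flips
      -- nearly balances the two terms.
      calc (4 / 125 : ℝ) ^ l ≤ ((4 / 5) ^ 6 * (1 / 5 * (4 / 5) ^ 2)) ^ l :=
            pow_le_pow_left₀ (by norm_num) (by norm_num) l
        _ = ((4 / 5 : ℝ) ^ 6) ^ l * ((1 / 5) ^ l * (4 / 5) ^ (2 * l)) := by
            rw [mul_pow, mul_pow (1 / 5 : ℝ), pow_mul]
        _ ≤ _ := by gcongr
  calc 1 / 2 * (4 / 25 : ℝ) ^ l = 1 / 2 * 5 ^ l * (4 / 125) ^ l := by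
        rw [mul_assoc, ← mul_pow]; norm_num
    _ ≤ ((3 * l).choose (2 * l) : ℝ) * (4 / 125) ^ l := by gcongr; linarith
    _ ≤ _ := by gcongr

/-! ### From protocols to the binary test. -/

/-- Positions with equal inputs scale both hypotheses alike and sum out to `1`; only the differing
ones count, and by symmetry of the channel their orientation does not matter. -/
theorem sum_min_prod_eq_testMass {Q : BinaryInputDMC Bool} (hQ : Q.IsBSC (1 / 5)) {n : ℕ}
    (x x' : Fin n → Bool) {a b : ℝ} :
    ∑ z : Fin n → Bool, min (a * ∏ i, Q.prob (x i) (z i)) (b * ∏ i, Q.prob (x' i) (z i)) =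
      testMass (Finset.univ.filter fun i => x i ≠ x' i).card a b := by
  induction n generalizing a b with
  | zero => simp [testMass]
  | succ n ih =>
    rw [← (Fin.consEquiv fun _ : Fin (n + 1) => Bool).sum_comp, Fintype.sum_prod_type]
    have h (c : Bool) : ∑ z : Fin n → Bool,
        min (a * ∏ i, Q.prob (x i) ((Fin.consEquiv fun _ : Fin (n + 1) => Bool) (c, z) i))
          (b * ∏ i, Q.prob (x' i) ((Fin.consEquiv fun _ : Fin (n + 1) => Bool) (c, z) i)) =
        testMass (Finset.univ.filter fun i : Fin n => x i.succ ≠ x' i.succ).card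
          (Q.prob (x 0) c * a) (Q.prob (x' 0) c * b) := by
      rw [← ih (fun i => x i.succ) (fun i => x' i.succ)]
      refine Finset.sum_congr rfl fun z _ => ?_
      simp only [Fin.consEquiv_apply, Fin.prod_univ_succ, Fin.cons_zero, Fin.cons_succ]
      congr 1 <;> ring
    rw [Fintype.sum_congr _ _ h, Fintype.sum_bool, Fin.card_filter_univ_succ]
    have hp (u c : Bool) : Q.prob u c = if u = c then 4 / 5 else 1 / 5 := by
      have := hQ u
      cases u <;> cases c <;> norm_num at this ⊢ <;> simp [this]
    cases x 0 <;> cases x' 0 <;>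
      simp only [hp, testMass, testMass_mul, ne_eq, not_true_eq_false, not_false_eq_true, if_true,
        if_false, reduceCtorEq,
        show (0 : ℝ) ≤ 1 / 5 by norm_num, show (0 : ℝ) ≤ 4 / 5 by norm_num] <;> ring

theorem BinaryInputDMC.IsReverseZ.prob_true_false {P : BinaryInputDMC Bool} {q : ℝ}
    (hP : P.IsReverseZ q) : P.prob true false = 0 := by
  have h := P.sum_prob true
  rw [Fintype.sum_bool, hP.1] at h
  linarith

/-- The teacher's first `t` observations are all `true` with probability `q ^ t` if `Θ = 0`. -/
theorem sum_prod_prob_of_prefix {P : BinaryInputDMC Bool} {q : ℝ} (hP : P.IsReverseZ q)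
    {n t : ℕ} (ht : t ≤ n) :
    ∑ y ∈ Fintype.piFinset fun i : Fin n => if (i : ℕ) < t then {true} else Finset.univ,
      ∏ i, P.prob false (y i) = q ^ t := by
  rw [← Finset.prod_univ_sum]
  have h (i : Fin n) : ∑ j ∈ (if (i : ℕ) < t then {true} else Finset.univ), P.prob false j =
      if (i : ℕ) < t then q else 1 := by
    split_ifs
    · rw [Finset.sum_singleton, hP.2]
    · exact P.sum_prob false
  rw [Finset.prod_congr rfl fun i _ => h i, Finset.prod_ite, Finset.prod_const,
    Finset.prod_const_one, mul_one, Fin.card_filter_val_lt, min_eq_right ht]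

/-- A lower bound on the error probability of any protocol: a student who does not err can tell
the all-`true` observations from those that merely start with `t` times `true`. -/
theorem testMass_le_two_mul_errorProb {P Q : BinaryInputDMC Bool} (hP : P.IsReverseZ (4 / 5))
    (hQ : Q.IsBSC (1 / 5)) (π : TeachingProtocol Bool Bool) {n t k : ℕ} (ht : t ≤ n)
    (hk : n ≤ t + k) : testMass k 1 ((4 / 5) ^ t) ≤ 2 * π.errorProb P Q n := by
  set w : ℝ := (4 / 5) ^ t
  have hw : 0 < w := by positivity
  set S := Fintype.piFinset fun i : Fin n => if (i : ℕ) < t then {true} else Finset.univ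
  set B : Bool → (Fin n → Bool) → ℝ := fun θ y => ∑ z : Fin n → Bool,
    if π.student n z = θ then 0 else ∏ i, Q.prob (π.teacher n i y) (z i) with hB
  set u : Fin n → Bool := fun _ => true
  have hBnn (θ y) : 0 ≤ B θ y := Finset.sum_nonneg fun z _ => by
    split_ifs
    · exact le_rfl
    · exact Finset.prod_nonneg fun i _ => Q.prob_nonneg _ _
  have hpnn (θ) (y : Fin n → Bool) : 0 ≤ ∏ i, P.prob θ (y i) :=
    Finset.prod_nonneg fun i _ => P.prob_nonneg _ _
  have herr : 2 * π.errorProb P Q n = ∑ y : Fin n → Bool, (∏ i, P.prob true (y i)) * B true y +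
      ∑ y : Fin n → Bool, (∏ i, P.prob false (y i)) * B false y := by
    rw [TeachingProtocol.errorProb, Fintype.sum_bool]
    simp only [TeachingProtocol.jointProb, hB, mul_add, Finset.mul_sum, mul_ite, mul_zero]
    refine congrArg₂ (· + ·) ?_ ?_ <;>
      refine Finset.sum_congr rfl fun y _ => Finset.sum_congr rfl fun z _ => ?_ <;>
      congr 1 <;> ring
  have h1 : B true u ≤ ∑ y : Fin n → Bool, (∏ i, P.prob true (y i)) * B true y := by
    have := Finset.single_le_sum (f := fun y : Fin n → Bool => (∏ i, P.prob true (y i)) * B true y)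
      (fun y _ => mul_nonneg (hpnn true y) (hBnn true y)) (Finset.mem_univ u)
    simpa [u, hP.1] using this
  have h2 : ∑ y ∈ S, (∏ i, P.prob false (y i)) * B false y ≤
      ∑ y : Fin n → Bool, (∏ i, P.prob false (y i)) * B false y :=
    Finset.sum_le_sum_of_subset_of_nonneg (Finset.subset_univ _) fun y _ _ =>
      mul_nonneg (hpnn false y) (hBnn false y)
  -- For each `z` the student errs under one of the two hypotheses, so it pays at least the smaller
  -- of the two masses.
  have h3 (y) (hy : y ∈ S) : testMass k 1 w ≤ B true u + w * B false y := by
    have hyt (i : Fin n) (hi : (i : ℕ) < t) : y i = true := by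
      have := Fintype.mem_piFinset.1 hy i
      simpa [hi] using this
    have hcard : (Finset.univ.filter fun i => π.teacher n i u ≠ π.teacher n i y).card ≤ k := by
      have hsub : (Finset.univ.filter fun i => π.teacher n i u ≠ π.teacher n i y) ⊆
          Finset.univ.filter fun i : Fin n => ¬ (i : ℕ) < t := by
        intro i
        simp only [Finset.mem_filter, Finset.mem_univ, true_and]
        refine mt fun hi => π.causal n i u y fun j hj => (hyt j ?_).symm
        exact lt_of_le_of_lt hj hi
      have h := Finset.card_filter_add_card_filter_not (s := Finset.univ)
        (fun i : Fin n => (i : ℕ) < t)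
      rw [Fin.card_filter_val_lt, Finset.card_univ, Fintype.card_fin] at h
      have := Finset.card_le_card hsub
      omega
    refine (testMass_antitone 1 w hcard).trans ?_
    dsimp only
    rw [← sum_min_prod_eq_testMass hQ, hB]
    simp only [Finset.mul_sum, ← Finset.sum_add_distrib]
    refine Finset.sum_le_sum fun z _ => ?_
    cases π.student n z <;> simp
  -- Average `h3` over `S`, whose total mass under `Θ = 0` is `w`. The weight `w` given to `B false
  -- y` makes this factor common to both terms, so it cancels.
  have h4 : w * testMass k 1 w ≤
      w * (B true u + ∑ y ∈ S, (∏ i, P.prob false (y i)) * B false y) := by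
    have h := Finset.sum_le_sum fun y hy => mul_le_mul_of_nonneg_left (h3 y hy) (hpnn false y)
    rw [← Finset.sum_mul, sum_prod_prob_of_prefix hP ht] at h
    simp only [mul_add, Finset.sum_add_distrib] at h
    rw [← Finset.sum_mul, sum_prod_prob_of_prefix hP ht] at h
    have hsum : ∑ y ∈ S, (∏ i, P.prob false (y i)) * (w * B false y) =
        w * ∑ y ∈ S, (∏ i, P.prob false (y i)) * B false y := by
      rw [Finset.mul_sum S]
      exact Finset.sum_congr rfl fun y _ => mul_left_comm _ _ _
    rwa [hsum, ← mul_add] at h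
  have h5 := le_of_mul_le_mul_left h4 hw
  linarith

/-! ### Bounds on the two rates. -/

theorem errorProb_ge {P Q : BinaryInputDMC Bool} (hP : P.IsReverseZ (4 / 5))
    (hQ : Q.IsBSC (1 / 5)) (π : TeachingProtocol Bool Bool) {n l : ℕ} (hl : n ≤ 9 * l) :
    1 / 4 * (4 / 25 : ℝ) ^ l ≤ π.errorProb P Q n := by
  -- The subtraction truncates: if `n < 3 * l` then `t = 0`, and `n ≤ t + 3 * l` still holds.
  have h1 := testMass_three_mul_ge l (n - 3 * l) (by omega)
  have h2 := testMass_le_two_mul_errorProb hP hQ π (n := n) (t := n - 3 * l) (k := 3 * l)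
    (by omega) (by omega)
  linarith

theorem learningRate_le {P Q : BinaryInputDMC Bool} (hP : P.IsReverseZ (4 / 5))
    (hQ : Q.IsBSC (1 / 5)) (π : TeachingProtocol Bool Bool) {r : ℝ}
    (hr : Real.log (25 / 4) / 9 < r) : π.learningRate P Q ≤ (r : EReal) := by
  refine limsup_le_of_le (by isBoundedDefault) ?_
  have hL : 0 < Real.log (25 / 4) := Real.log_pos (by norm_num)
  set L := Real.log (25 / 4)
  have hd : 0 < r - L / 9 := by linarith
  -- The slack in `r` pays, for large `n`, for the constant `1/4` and for rounding `n / 9` up.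
  filter_upwards [eventually_gt_atTop 0,
    eventually_ge_atTop ⌈(Real.log 4 + L) / (r - L / 9)⌉₊] with n hn0 hn
  have hn' : (0 : ℝ) < n := by exact_mod_cast hn0
  have hn2 : Real.log 4 + L ≤ n * (r - L / 9) := by
    rw [← div_le_iff₀ hd]
    exact Nat.ceil_le.1 hn
  have he := errorProb_ge hP hQ π (n := n) (l := n / 9 + 1) (by omega)
  have he0 : 0 < 1 / 4 * (4 / 25 : ℝ) ^ (n / 9 + 1) := by positivity
  rw [ENNReal.log_ofReal_of_pos (he0.trans_le he), ← EReal.coe_neg, ← EReal.coe_natCast,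
    ← EReal.coe_div, EReal.coe_le_coe_iff, div_le_iff₀ hn']
  have hlog := Real.log_le_log he0 he
  rw [Real.log_mul (by norm_num) (by positivity), Real.log_pow,
    show (1 / 4 : ℝ) = 4⁻¹ by norm_num, show (4 / 25 : ℝ) = (25 / 4)⁻¹ by norm_num,
    Real.log_inv, Real.log_inv] at hlog
  have hdiv : ((n / 9 + 1 : ℕ) : ℝ) ≤ n / 9 + 1 := by
    have := Nat.cast_div_le (α := ℝ) (m := n) (n := 9)
    push_cast at this ⊢
    linarith
  have := mul_le_mul_of_nonneg_right hdiv hL.le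
  linarith

theorem BinaryInputDMC.minMu_le_of_chernoffCoeff_eq {Y : Type*} [Fintype Y]
    (W : BinaryInputDMC Y) {s c : ℝ} (hs : s ∈ Set.Icc (0 : ℝ) 1) (hc : 0 < c)
    (h : chernoffCoeff (W.prob false) (W.prob true) s = c) : W.minMu ≤ (Real.log c : EReal) := by
  refine (iInf₂_le s hs).trans_eq ?_
  rw [BinaryInputDMC.mu, h, ENNReal.log_ofReal_of_pos hc]

theorem minMu_reverseZ_le {P : BinaryInputDMC Bool} {q : ℝ} (hP : P.IsReverseZ q) (hq : 0 < q) :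
    P.minMu ≤ (Real.log q : EReal) := by
  -- At `s = 0` only the output `true`, the common support, contributes.
  refine P.minMu_le_of_chernoffCoeff_eq (s := 0) (by simp) hq ?_
  simp [chernoffCoeff, hP.1, hP.2, hP.prob_true_false, hq.ne']

theorem minMu_bsc_le {Q : BinaryInputDMC Bool} (hQ : Q.IsBSC (1 / 5)) :
    Q.minMu ≤ (Real.log (4 / 5) : EReal) := by
  refine Q.minMu_le_of_chernoffCoeff_eq (s := 1 / 2) (by norm_num) (by norm_num) ?_
  have h0 := hQ false
  have h1 := hQ true
  norm_num at h0 h1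
  simp only [chernoffCoeff, Fintype.sum_bool, h0, h1]
  norm_num
  have h : (1 / 5 : ℝ) ^ (1 / 2 : ℝ) * (4 / 5) ^ (1 / 2 : ℝ) = 2 / 5 := by
    rw [← Real.mul_rpow (by norm_num) (by norm_num), ← Real.sqrt_eq_rpow,
      show (1 / 5 * (4 / 5) : ℝ) = (2 / 5) ^ 2 by norm_num]
    exact Real.sqrt_sq (by norm_num)
  linarith

theorem exists_isReverseZ {q : ℝ} (h0 : 0 ≤ q) (h1 : q ≤ 1) :
    ∃ P : BinaryInputDMC Bool, P.IsReverseZ q :=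
  ⟨{ prob := fun x y => if x then (if y then 1 else 0) else (if y then q else 1 - q)
     prob_nonneg := by
       intro x y
       cases x <;> cases y <;> simp [h0, h1]
     sum_prob := by
       intro x
       cases x <;> simp }, by simp [BinaryInputDMC.IsReverseZ]⟩

theorem exists_isBSC {q : ℝ} (h0 : 0 ≤ q) (h1 : q ≤ 1) : ∃ Q : BinaryInputDMC Bool, Q.IsBSC q :=
  ⟨{ prob := fun x y => if x = y then 1 - q else q
     prob_nonneg := by
       intro x y
       split_ifs <;> linarith
     sum_prob := by
       intro x
       cases x <;> simp }, fun x => by simp⟩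

theorem mainTheorem7 :
    ∃ P Q : BinaryInputDMC Bool, P.IsReverseZ (4 / 5) ∧ Q.IsBSC (1 / 5) ∧
      optimalLearningRate P Q < -max P.minMu Q.minMu := by
  obtain ⟨P, hP⟩ := exists_isReverseZ (q := 4 / 5) (by norm_num) (by norm_num)
  obtain ⟨Q, hQ⟩ := exists_isBSC (q := 1 / 5) (by norm_num) (by norm_num)
  refine ⟨P, Q, hP, hQ, ?_⟩
  -- This amounts to `25/4 < (5/4)^9 ≈ 7.45`.
  have hlog : Real.log (25 / 4) / 9 < -Real.log (4 / 5) := by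
    rw [← Real.log_inv, div_lt_iff₀ (by norm_num), mul_comm]
    have h := Real.log_pow (4 / 5 : ℝ)⁻¹ 9
    push_cast at h
    rw [← h]
    exact Real.log_lt_log (by norm_num) (by norm_num)
  obtain ⟨r, hr1, hr2⟩ := exists_between hlog
  have hmax : max P.minMu Q.minMu ≤ (Real.log (4 / 5) : EReal) :=
    max_le (minMu_reverseZ_le hP (by norm_num)) (minMu_bsc_le hQ)
  calc optimalLearningRate P Q ≤ (r : EReal) := iSup_le fun π => learningRate_le hP hQ π hr1
    _ < ((-Real.log (4 / 5) : ℝ) : EReal) := EReal.coe_lt_coe_iff.2 hr2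
    _ = -(Real.log (4 / 5) : EReal) := EReal.coe_neg _
    _ ≤ _ := EReal.neg_le_neg_iff.2 hmax
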